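/- Let $\mathbb{K}$ be $\mathbb{R}$ or $\mathbb{C}$, write $\mathbb{P}^k$ for the $k$-dimensional projective space over $\mathbb{K}$, and let $n \ge 8$. A flatland camera is a linear projection $A : \mathbb{P}^2 \dashrightarrow \mathbb{P}^1$ given by a $2\times 3$ matrix over $\mathbb{K}$ of rank $2$; it is defined at every point of $\mathbb{P}^2$ except its center, the point spanned by the null space of the matrix. Then for generic labeled sets $\mathcal{X} = \{x_1,\dots,x_n\}$ and $\mathcal{Y} = \{y_1,\dots,y_n\}$ of points in $\mathbb{P}^2$, there is no pair $(A,B)$ of flatland cameras that projects $\mathcal{X}$ and $\mathcal{Y}$ to the same image in $\mathbb{P}^1$. That is, there is a dense Zariski-open subset $U \subseteq (\mathbb{P}^2)^n \times (\mathbb{P}^2)^n$ such that for every $(\mathcal{X},\mathcal{Y}) \in U$ there are no flatland cameras $A, B$ such that, for all $i = 1,\dots,n$, $A$ is defined at $x_i$, $B$ is defined at $y_i$, and $A x_i = B y_i$ in $\mathbb{P}^1$. -/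

import Mathlib

open scoped LinearAlgebra.Projectivization Matrix

/-- The projective space `ℙᵏ` over `𝕜`, with homogeneous coordinates indexed by `Fin (k + 1)`. -/
abbrev ProjSpace (𝕜 : Type*) [Field 𝕜] (k : ℕ) : Type _ := ℙ 𝕜 (Fin (k + 1) → 𝕜)

/-- A flatland camera `ℙ² ⇢ ℙ¹`, given by a `2 × 3` matrix of rank `2`. -/
structure FlatlandCamera (𝕜 : Type*) [Field 𝕜] where
  mat : Matrix (Fin 2) (Fin 3) 𝕜
  rank_eq : mat.rank = 2

/-- The camera `A` is defined at `x` (that is, `x` is not its center) and maps `x` to `p`.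
This does not depend on the representative of `x`. -/
def FlatlandCamera.ProjectsTo {𝕜 : Type*} [Field 𝕜] (A : FlatlandCamera 𝕜)
    (x : ProjSpace 𝕜 2) (p : ProjSpace 𝕜 1) : Prop :=
  ∃ h : A.mat *ᵥ x.rep ≠ 0, Projectivization.mk 𝕜 (A.mat *ᵥ x.rep) h = p

/-- The cameras `A` and `B` project the labeled points `X` and `Y` to the same labeled image
in `ℙ¹`. -/
def SameImage {𝕜 : Type*} [Field 𝕜] {n : ℕ} (A B : FlatlandCamera 𝕜)
    (X Y : Fin n → ProjSpace 𝕜 2) : Prop :=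
  ∃ P : Fin n → ProjSpace 𝕜 1, ∀ i, A.ProjectsTo (X i) (P i) ∧ B.ProjectsTo (Y i) (P i)

/-- A polynomial in the homogeneous coordinates of a family of points of `ℙᵏ` is multihomogeneous
if it is homogeneous in the coordinates of each point separately. -/
def IsMultihomogeneous {𝕜 : Type*} [Field 𝕜] {ι : Type*} [DecidableEq ι] {k : ℕ}
    (f : MvPolynomial (ι × Fin (k + 1)) 𝕜) : Prop :=
  ∃ d : ι → ℕ, f.IsWeightedHomogeneous (fun v => (Pi.single v.1 1 : ι → ℕ)) d

/-- The nonvanishing locus of `f` in `(ℙᵏ)^ι`. For multihomogeneous `f` it does not depend on the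
representatives. -/
def nonvanishingLocus {𝕜 : Type*} [Field 𝕜] {ι : Type*} {k : ℕ}
    (f : MvPolynomial (ι × Fin (k + 1)) 𝕜) : Set (ι → ProjSpace 𝕜 k) :=
  {z | MvPolynomial.eval (fun v => (z v.1).rep v.2) f ≠ 0}

/-- The Zariski topology on `(ℙᵏ)^ι`: the topology generated by the nonvanishing loci of
multihomogeneous polynomials (not the product topology). -/
abbrev zariskiTopology (𝕜 : Type*) [Field 𝕜] (ι : Type*) [DecidableEq ι] (k : ℕ) :
    TopologicalSpace (ι → ProjSpace 𝕜 k) :=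
  TopologicalSpace.generateFrom
    {U | ∃ f : MvPolynomial (ι × Fin (k + 1)) 𝕜, IsMultihomogeneous f ∧ U = nonvanishingLocus f}

/-- A property of pairs `(X, Y)` of `n` labeled points of `ℙ²` holds generically if it holds on a
dense Zariski-open subset of `(ℙ²)ⁿ × (ℙ²)ⁿ`. -/
def HoldsGenerically {𝕜 : Type*} [Field 𝕜] {n : ℕ}
    (Q : (Fin n → ProjSpace 𝕜 2) → (Fin n → ProjSpace 𝕜 2) → Prop) : Prop :=
  ∃ U : Set (Fin n ⊕ Fin n → ProjSpace 𝕜 2),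
    @IsOpen _ (zariskiTopology 𝕜 (Fin n ⊕ Fin n) 2) U ∧
    @Dense _ (zariskiTopology 𝕜 (Fin n ⊕ Fin n) 2) U ∧
    ∀ X Y, Sum.elim X Y ∈ U → Q X Y

/-!
If cameras `A` and `B` give `xᵢ` and `yᵢ` the same image for all `i`, then `A xᵢ` and `B yᵢ` are
linearly dependent, so the bilinear form `(u, v) ↦ det (A u, B v)` vanishes at every pair
`(xᵢ, yᵢ)`. Its matrix is nonzero, and it is singular because it factors through a plane. But
vanishing at eight pairs is eight linear conditions on the nine entries of a bilinear form on `𝕜³`: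
the vector of maximal minors of this system is a form `F` to which every solution is proportional
as soon as `F ≠ 0`. Hence no singular solution exists where `det F ≠ 0`, and `det F` is a
multihomogeneous polynomial in the points. It is not the zero polynomial, since eight pairs of
vectors can be chosen whose only common forms are the scalar multiples of the standard dot product.
-/

section WeightedHomogeneous

variable {σ R M : Type*} [AddCommMonoid M] {w : σ → M}

theorem eval_mul_of_isWeightedHomogeneous [CommSemiring R] {d : M} {f : MvPolynomial σ R}
    (hf : f.IsWeightedHomogeneous w d) (χ : Multiplicative M →* R) (x : σ → R) :
    MvPolynomial.eval (fun v => χ (.ofAdd (w v)) * x v) f =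
      χ (.ofAdd d) * MvPolynomial.eval x f := by
  rw [MvPolynomial.eval_eq, MvPolynomial.eval_eq, Finset.mul_sum]
  refine Finset.sum_congr rfl fun m hm => ?_
  have hχ : ∏ v ∈ m.support, χ (.ofAdd (w v)) ^ m v = χ (.ofAdd d) := by
    rw [← hf (MvPolynomial.mem_support_iff.mp hm), Finsupp.weight_apply, Finsupp.sum, ofAdd_sum,
      map_prod]
    simp only [ofAdd_nsmul, map_pow]
  simp only [mul_pow, Finset.prod_mul_distrib, hχ]
  ring

theorem isWeightedHomogeneous_det {m : Type*} [Fintype m] [DecidableEq m] [CommRing R]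
    {d : m → M} {T : Matrix m m (MvPolynomial σ R)}
    (hT : ∀ i j, (T i j).IsWeightedHomogeneous w (d i)) :
    T.det.IsWeightedHomogeneous w (∑ i, d i) := by
  rw [Matrix.det_apply]
  refine .sum _ _ _ fun τ _ => ?_
  have hprod : (∏ i, T (τ i) i).IsWeightedHomogeneous w (∑ i, d i) := by
    rw [← Equiv.sum_comp τ d]
    exact .prod _ _ _ fun i _ => hT (τ i) i
  exact (MvPolynomial.weightedHomogeneousSubmodule R w _).smul_of_tower_mem
    (Equiv.Perm.sign τ : ℤ) hprod

end WeightedHomogeneous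

section Zariski

variable {K ι : Type*} [Field K] {k : ℕ} {f g : MvPolynomial (ι × Fin (k + 1)) K}

theorem nonvanishingLocus_mul (f g : MvPolynomial (ι × Fin (k + 1)) K) :
    nonvanishingLocus (f * g) = nonvanishingLocus f ∩ nonvanishingLocus g := by
  ext z
  simp [nonvanishingLocus]

variable [DecidableEq ι]

theorem IsMultihomogeneous.mul (hf : IsMultihomogeneous f) (hg : IsMultihomogeneous g) :
    IsMultihomogeneous (f * g) :=
  let ⟨d, hd⟩ := hf
  let ⟨e, he⟩ := hg
  ⟨d + e, MvPolynomial.IsWeightedHomogeneous.mul hd he⟩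

theorem IsMultihomogeneous.eval_units_mul_eq_zero_iff [Finite ι] (hf : IsMultihomogeneous f)
    (a : ι → Kˣ) (x : ι × Fin (k + 1) → K) :
    MvPolynomial.eval (fun v => a v.1 * x v) f = 0 ↔ MvPolynomial.eval x f = 0 := by
  have := Fintype.ofFinite ι
  obtain ⟨d, hd⟩ := hf
  let χ : Multiplicative (ι → ℕ) →* Kˣ :=
    { toFun e := ∏ i, a i ^ e.toAdd i
      map_one' := by simp
      map_mul' := by simp [pow_add, Finset.prod_mul_distrib] }
  have hχ (i : ι) : χ (.ofAdd (Pi.single i 1)) = a i := by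
    simp [χ, Pi.single_apply]
  have heval := eval_mul_of_isWeightedHomogeneous hd ((Units.coeHom K).comp χ) x
  simp only [MonoidHom.comp_apply, Units.coeHom_apply, hχ] at heval
  rw [heval, Units.mul_right_eq_zero]

theorem IsMultihomogeneous.mk_mem_nonvanishingLocus_iff [Finite ι] (hf : IsMultihomogeneous f)
    {x : ι → Fin (k + 1) → K} (hx : ∀ i, x i ≠ 0) :
    (fun i => Projectivization.mk K (x i) (hx i)) ∈ nonvanishingLocus f ↔
      MvPolynomial.eval (fun v => x v.1 v.2) f ≠ 0 := by
  choose a ha using fun i => Projectivization.exists_smul_eq_mk_rep K (x i) (hx i)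
  have hrep : (fun v : ι × Fin (k + 1) => (Projectivization.mk K (x v.1) (hx v.1)).rep v.2) =
      fun v => a v.1 * x v.1 v.2 := by
    ext v
    rw [← ha]
    rfl
  rw [nonvanishingLocus, Set.mem_ofPred_eq, hrep, Ne,
    hf.eval_units_mul_eq_zero_iff a fun v => x v.1 v.2]

theorem IsMultihomogeneous.nonvanishingLocus_nonempty [Infinite K] [Finite ι]
    (hf : IsMultihomogeneous f) (hf0 : f ≠ 0) : (nonvanishingLocus f).Nonempty := by
  have := Fintype.ofFinite ι
  -- The extra factor forces every block of coordinates to be a nonzero vector.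
  have hprod : f * ∏ i : ι, MvPolynomial.X (i, 0) ≠ 0 :=
    mul_ne_zero hf0 (Finset.prod_ne_zero_iff.mpr fun i _ => MvPolynomial.X_ne_zero _)
  obtain ⟨x, hx⟩ : ∃ x, MvPolynomial.eval x (f * ∏ i : ι, MvPolynomial.X (i, 0)) ≠ 0 := by
    contrapose! hprod
    exact MvPolynomial.funext fun x => by rw [hprod x, map_zero]
  simp only [map_mul, map_prod, MvPolynomial.eval_X, mul_ne_zero_iff, Finset.prod_ne_zero_iff,
    Finset.mem_univ, true_imp_iff] at hx
  exact ⟨_, (hf.mk_mem_nonvanishingLocus_iff (x := fun i j => x (i, j))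
    fun i h => hx.2 i (congrFun h 0)).mpr hx.1⟩

theorem IsMultihomogeneous.isOpen_nonvanishingLocus (hf : IsMultihomogeneous f) :
    @IsOpen _ (zariskiTopology K ι k) (nonvanishingLocus f) :=
  TopologicalSpace.isOpen_generateFrom_of_mem ⟨f, hf, rfl⟩

theorem IsMultihomogeneous.dense_nonvanishingLocus [Infinite K] [Finite ι]
    (hf : IsMultihomogeneous f) (hf0 : f ≠ 0) :
    @Dense _ (zariskiTopology K ι k) (nonvanishingLocus f) := by
  let := zariskiTopology K ι k
  have hbasis := TopologicalSpace.isTopologicalBasis_of_subbasis_of_inter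
    (r := {U : Set (ι → ProjSpace K k) | ∃ f : MvPolynomial (ι × Fin (k + 1)) K,
      IsMultihomogeneous f ∧ U = nonvanishingLocus f}) rfl (by
    rintro _ ⟨g, hg, rfl⟩ _ ⟨h, hh, rfl⟩
    exact ⟨g * h, hg.mul hh, (nonvanishingLocus_mul g h).symm⟩)
  refine hbasis.dense_iff.mpr ?_
  rintro _ (rfl | ⟨g, hg, rfl⟩) ⟨z, hz⟩
  · simpa using hf.nonvanishingLocus_nonempty hf0
  · have hg0 : g ≠ 0 := by
      rintro rfl
      exact hz (map_zero _)
    rw [← nonvanishingLocus_mul]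
    exact (hg.mul hf).nonvanishingLocus_nonempty (mul_ne_zero hg0 hf0)

end Zariski

section CofactorVector

variable {m R S : Type*} [DecidableEq m] {i : m}

/-- The square matrix obtained from `M`, whose rows are indexed by all of `m` except `i`, by
putting `w` in the missing row `i`. -/
def adjoinRow (M : Matrix {r // r ≠ i} m R) (w : m → R) : Matrix m m R :=
  Matrix.of fun r => if h : r = i then w else M ⟨r, h⟩

@[simp]
theorem adjoinRow_self (M : Matrix {r // r ≠ i} m R) (w : m → R) : adjoinRow M w i = w :=
  dif_pos rfl

theorem adjoinRow_of_ne (M : Matrix {r // r ≠ i} m R) (w : m → R) {r : m} (hr : r ≠ i) :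
    adjoinRow M w r = M ⟨r, hr⟩ :=
  dif_neg hr

theorem updateRow_adjoinRow (M : Matrix {r // r ≠ i} m R) (w w' : m → R) :
    (adjoinRow M w).updateRow i w' = adjoinRow M w' := by
  ext r c
  obtain rfl | hr := eq_or_ne r i
  · simp
  · simp [hr, adjoinRow_of_ne]

variable [Fintype m] [CommRing R] [CommRing S]

theorem adjoinRow_mulVec_of_mulVec_eq_zero {M : Matrix {r // r ≠ i} m R} {v : m → R}
    (hv : M *ᵥ v = 0) (w : m → R) : adjoinRow M w *ᵥ v = Pi.single i (w ⬝ᵥ v) := by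
  ext r
  obtain rfl | hr := eq_or_ne r i
  · simp [Matrix.mulVec]
  · simpa [Matrix.mulVec, hr, adjoinRow_of_ne] using congrFun hv ⟨r, hr⟩

/-- The vector of signed maximal minors of a matrix with one row fewer than columns, also known as
the generalized cross product of its rows. The minor omitting column `c` is encoded as the
determinant with the `c`-th unit vector adjoined as a row. -/
def cofactorVec (M : Matrix {r // r ≠ i} m R) (c : m) : R :=
  (adjoinRow M (Pi.single c 1)).det

theorem adjugate_adjoinRow_apply (M : Matrix {r // r ≠ i} m R) (w : m → R) (c : m) :
    (adjoinRow M w).adjugate c i = cofactorVec M c := by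
  rw [Matrix.adjugate_apply, updateRow_adjoinRow, cofactorVec]

theorem map_cofactorVec (φ : R →+* S) (M : Matrix {r // r ≠ i} m R) (c : m) :
    φ (cofactorVec M c) = cofactorVec (M.map φ) c := by
  rw [cofactorVec, cofactorVec, RingHom.map_det]
  congr 1
  ext r c'
  obtain rfl | hr := eq_or_ne r i
  · simp [Pi.single_apply, apply_ite φ]
  · simp [hr, adjoinRow_of_ne]

theorem cofactorVec_smul_eq_smul_cofactorVec {M : Matrix {r // r ≠ i} m R} {v : m → R}
    (hv : M *ᵥ v = 0) (c : m) : cofactorVec M c • v = v c • cofactorVec M := by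
  set T := adjoinRow M (Pi.single c 1)
  calc cofactorVec M c • v = T.adjugate *ᵥ (T *ᵥ v) := by
        rw [Matrix.mulVec_mulVec, Matrix.adjugate_mul, Matrix.smul_mulVec, Matrix.one_mulVec,
          cofactorVec]
    _ = T.adjugate *ᵥ Pi.single i (v c) := by
        rw [adjoinRow_mulVec_of_mulVec_eq_zero hv, single_one_dotProduct]
    _ = v c • cofactorVec M := by
        ext c'
        simp [T, adjugate_adjoinRow_apply, mul_comm]

theorem cofactorVec_ne_zero [IsDomain R] {M : Matrix {r // r ≠ i} m R} {c : m}
    (hM : ∀ v, M *ᵥ v = 0 → v c = 0 → v = 0) : cofactorVec M c ≠ 0 := by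
  intro hdet
  obtain ⟨v, hv0, hv⟩ := Matrix.exists_mulVec_eq_zero_iff.mpr hdet
  refine hv0 (hM v (funext fun r => ?_) ?_)
  · simpa [Matrix.mulVec, adjoinRow_of_ne _ _ r.2] using congrFun hv r
  · simpa [Matrix.mulVec] using congrFun hv i

theorem isWeightedHomogeneous_cofactorVec {σ M : Type*} [AddCommMonoid M] {w : σ → M}
    {T : Matrix {r // r ≠ i} m (MvPolynomial σ R)} {d : {r // r ≠ i} → M}
    (hT : ∀ r c, (T r c).IsWeightedHomogeneous w (d r)) (c : m) :
    (cofactorVec T c).IsWeightedHomogeneous w (∑ r, d r) := by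
  have hsum : ∑ r, (if h : r = i then 0 else d ⟨r, h⟩) = ∑ r, d r := by
    rw [Fintype.sum_eq_add_sum_subtype_ne _ i, dif_pos rfl, zero_add]
    exact Finset.sum_congr rfl fun r _ => dif_neg r.2
  rw [← hsum]
  refine isWeightedHomogeneous_det fun r c' => ?_
  obtain rfl | hr := eq_or_ne r i
  · rw [adjoinRow_self, dif_pos rfl, Pi.single_apply]
    split_ifs
    exacts [MvPolynomial.isWeightedHomogeneous_one _ _,
      MvPolynomial.isWeightedHomogeneous_zero _ _ _]
  · rw [adjoinRow_of_ne _ _ hr, dif_neg hr]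
    exact hT _ _

end CofactorVector

section InterpolatingForm

variable {κ ι R S : Type*} [CommRing R] [CommRing S]

/-- The matrix whose rows are the tensors `x r ⊗ y r`, flattened in the column-major order of
`Matrix.vec`. Its kernel consists of the bilinear forms vanishing at all pairs `(x r, y r)`. -/
def tensorRows (x y : κ → ι → R) : Matrix κ (ι × ι) R :=
  Matrix.of fun r => (Matrix.vecMulVec (x r) (y r)).vec

theorem tensorRows_mulVec_vec [Fintype ι] (x y : κ → ι → R) (G : Matrix ι ι R) :
    tensorRows x y *ᵥ G.vec = fun r => x r ⬝ᵥ G *ᵥ y r := by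
  ext r
  calc (tensorRows x y *ᵥ G.vec) r
      = (Matrix.vecMulVec (x r) (y r)).vec ⬝ᵥ G.vec := rfl
    _ = x r ⬝ᵥ G *ᵥ y r := by
        rw [Matrix.vec_dotProduct_vec, Matrix.transpose_vecMulVec, Matrix.vecMulVec_mul,
          Matrix.trace_vecMulVec, dotProduct_comm, Matrix.dotProduct_mulVec]

variable [Fintype ι] [DecidableEq ι] {o : ι}

/-- The bilinear form vanishing at `|ι|² - 1` given pairs of vectors, with the maximal minors of
the linear system as its entries. The pairs are labeled by the positions in an `ι × ι` matrix other
than `(o, o)`, so that the system becomes square when one row is adjoined. -/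
def interpolatingForm (x y : {r // r ≠ (o, o)} → ι → R) : Matrix ι ι R :=
  Matrix.of fun j k => cofactorVec (tensorRows x y) (k, j)

theorem map_interpolatingForm (φ : R →+* S) (x y : {r // r ≠ (o, o)} → ι → R) :
    (interpolatingForm x y).map φ =
      interpolatingForm (fun r j => φ (x r j)) (fun r j => φ (y r j)) := by
  have hrows : (tensorRows x y).map φ =
      tensorRows (fun r j => φ (x r j)) (fun r j => φ (y r j)) := by
    ext r c
    simp [tensorRows, Matrix.vecMulVec_apply]
  ext j k
  simp only [interpolatingForm, Matrix.map_apply, Matrix.of_apply, map_cofactorVec, hrows]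

theorem interpolatingForm_smul_eq_smul_interpolatingForm {x y : {r // r ≠ (o, o)} → ι → R}
    {G : Matrix ι ι R} (hG : ∀ r, x r ⬝ᵥ G *ᵥ y r = 0) (j k : ι) :
    interpolatingForm x y j k • G = G j k • interpolatingForm x y := by
  have hker : tensorRows x y *ᵥ G.vec = 0 := (tensorRows_mulVec_vec x y G).trans (funext hG)
  exact Matrix.vec_inj.mp (cofactorVec_smul_eq_smul_cofactorVec hker (k, j))

theorem det_interpolatingForm_eq_zero [IsDomain R] {x y : {r // r ≠ (o, o)} → ι → R}
    {G : Matrix ι ι R} (hG : ∀ r, x r ⬝ᵥ G *ᵥ y r = 0) (hG0 : G ≠ 0) (hdet : G.det = 0) :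
    (interpolatingForm x y).det = 0 := by
  obtain ⟨j, k, hjk⟩ : ∃ j k, G j k ≠ 0 := by
    contrapose! hG0
    exact Matrix.ext hG0
  have h := congrArg Matrix.det (interpolatingForm_smul_eq_smul_interpolatingForm hG j k)
  rw [Matrix.det_smul, Matrix.det_smul, hdet, mul_zero] at h
  exact (mul_eq_zero.mp h.symm).resolve_left (pow_ne_zero _ hjk)

theorem det_interpolatingForm_ne_zero [IsDomain R] {x y : {r // r ≠ (o, o)} → ι → R}
    (hxy : ∀ G : Matrix ι ι R, (∀ r, x r ⬝ᵥ G *ᵥ y r = 0) ↔ G = G o o • 1) :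
    (interpolatingForm x y).det ≠ 0 := by
  have hone : ∀ r, x r ⬝ᵥ (1 : Matrix ι ι R) *ᵥ y r = 0 := (hxy 1).mpr (by simp)
  have hscalar : interpolatingForm x y o o • 1 = interpolatingForm x y := by
    simpa using interpolatingForm_smul_eq_smul_interpolatingForm hone o o
  have hentry : interpolatingForm x y o o ≠ 0 := by
    refine cofactorVec_ne_zero fun v hv hvo => ?_
    obtain ⟨G, rfl⟩ := Matrix.vec_bijective.surjective v
    have hG := (hxy G).mp (congrFun ((tensorRows_mulVec_vec x y G).symm.trans hv))
    rw [Matrix.vec_eq_zero_iff, hG, show G o o = 0 from hvo, zero_smul]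
  rw [← hscalar, Matrix.det_smul, Matrix.det_one, mul_one]
  exact pow_ne_zero _ hentry

variable (R o) in
theorem exists_pairs_forall_isotropic_iff_eq_smul_one :
    ∃ x y : {r : ι × ι // r ≠ (o, o)} → ι → R,
      ∀ G : Matrix ι ι R, (∀ r, x r ⬝ᵥ G *ᵥ y r = 0) ↔ G = G o o • 1 := by
  refine ⟨fun r => if r.1.1 = r.1.2 then Pi.single r.1.1 1 + Pi.single o 1 else Pi.single r.1.1 1,
    fun r => if r.1.1 = r.1.2 then Pi.single r.1.1 1 - Pi.single o 1 else Pi.single r.1.2 1,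
    fun G => ⟨fun hG => ?_, fun hG => ?_⟩⟩
  · have hoff {j k : ι} (hjk : j ≠ k) : G j k = 0 := by
      simpa [hjk] using hG ⟨(j, k), fun h => hjk (by simp_all)⟩
    have hdiag (j : ι) : G j j = G o o := by
      obtain rfl | hj := eq_or_ne j o
      · rfl
      · simpa [Matrix.mulVec_sub, hoff hj, hoff hj.symm, sub_eq_zero] using
          hG ⟨(j, j), fun h => hj (by simp_all)⟩
    ext j k
    obtain rfl | hjk := eq_or_ne j k
    · simp [hdiag j]
    · simp [hoff hjk, hjk]
  · rintro ⟨⟨j, k⟩, hr⟩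
    rw [hG, Matrix.smul_mulVec, Matrix.one_mulVec, dotProduct_smul]
    obtain rfl | hjk := eq_or_ne j k
    · have hj : j ≠ o := by
        rintro rfl
        exact hr rfl
      simp [hj, hj.symm]
    · simp [hjk]

end InterpolatingForm

section InterpolatingDetPoly

variable {L ι : Type*} [Fintype ι] [DecidableEq ι] {o : ι}
  (R : Type*) [CommRing R] (σ : {r // r ≠ (o, o)} → L)

/-- The determinant of the interpolating form as a polynomial in the coordinates of labeled vectors
`xₗ` (variables `(Sum.inl l, j)`) and `yₗ` (variables `(Sum.inr l, j)`), where `σ` selects the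
labels of the pairs to interpolate. -/
noncomputable def interpolatingDetPoly : MvPolynomial ((L ⊕ L) × ι) R :=
  (interpolatingForm (fun r j => MvPolynomial.X (Sum.inl (σ r), j))
    (fun r j => MvPolynomial.X (Sum.inr (σ r), j))).det

theorem eval_interpolatingDetPoly (z : (L ⊕ L) × ι → R) :
    MvPolynomial.eval z (interpolatingDetPoly R σ) =
      (interpolatingForm (fun r j => z (Sum.inl (σ r), j))
        (fun r j => z (Sum.inr (σ r), j))).det := by
  rw [interpolatingDetPoly, RingHom.map_det, RingHom.mapMatrix_apply, map_interpolatingForm]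
  simp only [MvPolynomial.eval_X]

variable {σ} in
theorem interpolatingDetPoly_ne_zero [IsDomain R] (hσ : σ.Injective) :
    interpolatingDetPoly R σ ≠ 0 := by
  obtain ⟨x, y, hxy⟩ := exists_pairs_forall_isotropic_iff_eq_smul_one R o
  intro h
  have heval := eval_interpolatingDetPoly R σ fun v =>
    Sum.elim (Function.extend σ x 0) (Function.extend σ y 0) v.1 v.2
  simp only [Sum.elim_inl, Sum.elim_inr, hσ.extend_apply, h, map_zero] at heval
  exact det_interpolatingForm_ne_zero hxy heval.symm

theorem isMultihomogeneous_interpolatingDetPoly [DecidableEq L] {K : Type*} [Field K] {k : ℕ}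
    {o : Fin (k + 1)} (σ : {r // r ≠ (o, o)} → L) :
    IsMultihomogeneous (interpolatingDetPoly K σ) :=
  ⟨_, isWeightedHomogeneous_det (d := fun _ => _) fun _ _ =>
    isWeightedHomogeneous_cofactorVec
      (d := fun r => Pi.single (Sum.inl (σ r)) 1 + Pi.single (Sum.inr (σ r)) 1)
      (fun _ _ => (MvPolynomial.isWeightedHomogeneous_X _ _ _).mul
        (MvPolynomial.isWeightedHomogeneous_X _ _ _)) _⟩

end InterpolatingDetPoly

section FundamentalMatrix

variable {ι R : Type*} [Fintype ι]

/-- The fundamental matrix of a pair of cameras with target `ℙ¹`, that is, the matrix of the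
bilinear form `(u, v) ↦ det (A u, B v)`. -/
def fundamentalMatrix [CommRing R] (A B : Matrix (Fin 2) ι R) : Matrix ι ι R :=
  Aᵀ * (!![0, 1; -1, 0] : Matrix (Fin 2) (Fin 2) R) * B

theorem dotProduct_fundamentalMatrix_mulVec [CommRing R] (A B : Matrix (Fin 2) ι R)
    (u v : ι → R) :
    u ⬝ᵥ fundamentalMatrix A B *ᵥ v = (Matrix.of ![A *ᵥ u, B *ᵥ v]).det := by
  calc u ⬝ᵥ fundamentalMatrix A B *ᵥ v
      = A *ᵥ u ⬝ᵥ !![0, 1; -1, 0] *ᵥ (B *ᵥ v) := by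
        rw [fundamentalMatrix, ← Matrix.mulVec_mulVec, ← Matrix.mulVec_mulVec,
          Matrix.dotProduct_mulVec, Matrix.vecMul_transpose]
    _ = (Matrix.of ![A *ᵥ u, B *ᵥ v]).det := by
        generalize A *ᵥ u = a, B *ᵥ v = b
        simp only [Matrix.det_fin_two, dotProduct, Fin.sum_univ_two, Matrix.mulVec,
          Matrix.of_apply, Matrix.cons_val', Matrix.cons_val_fin_one, Matrix.cons_val_zero,
          Matrix.cons_val_one]
        ring

theorem det_fundamentalMatrix_eq_zero [DecidableEq ι] [CommRing R] [IsDomain R]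
    (hι : 2 < Fintype.card ι) (A B : Matrix (Fin 2) ι R) : (fundamentalMatrix A B).det = 0 := by
  by_contra hdet
  have hrank : (fundamentalMatrix A B).rank ≤ 2 :=
    (Matrix.rank_mul_le_right _ B).trans B.rank_le_card_height
  rw [Matrix.rank_of_det_ne_zero hdet] at hrank
  exact hι.not_ge hrank

theorem mulVec_surjective_of_rank_eq_card {m K : Type*} [Fintype m] [Field K] {A : Matrix m ι K}
    (hA : A.rank = Fintype.card m) : Function.Surjective (A *ᵥ ·) :=
  LinearMap.range_eq_top.mp <| Submodule.eq_top_of_finrank_eq (S := A.mulVecLin.range) <|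
    hA.trans (Module.finrank_fintype_fun_eq_card K).symm

theorem fundamentalMatrix_ne_zero {K : Type*} [Field K] {A B : Matrix (Fin 2) ι K}
    (hA : A.rank = 2) (hB : B.rank = 2) : fundamentalMatrix A B ≠ 0 := by
  intro h
  obtain ⟨u, hu : A *ᵥ u = ![1, 0]⟩ := mulVec_surjective_of_rank_eq_card (A := A) (by simpa) ![1, 0]
  obtain ⟨v, hv : B *ᵥ v = ![0, 1]⟩ := mulVec_surjective_of_rank_eq_card (A := B) (by simpa) ![0, 1]
  simpa [h, hu, hv] using dotProduct_fundamentalMatrix_mulVec A B u v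

theorem SameImage.dotProduct_fundamentalMatrix_mulVec_eq_zero {K : Type*} [Field K] {n : ℕ}
    {A B : FlatlandCamera K} {X Y : Fin n → ProjSpace K 2} (h : SameImage A B X Y) (i : Fin n) :
    (X i).rep ⬝ᵥ fundamentalMatrix A.mat B.mat *ᵥ (Y i).rep = 0 := by
  obtain ⟨P, hP⟩ := h
  obtain ⟨⟨hA, hAP⟩, hB, hBP⟩ := hP i
  obtain ⟨a, ha⟩ := (Projectivization.mk_eq_mk_iff' K _ _ hA hB).mp (hAP.trans hBP.symm)
  rw [dotProduct_fundamentalMatrix_mulVec, ← ha]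
  simp only [Matrix.det_fin_two, Matrix.of_apply, Matrix.cons_val_zero, Matrix.cons_val_one,
    Pi.smul_apply, smul_eq_mul]
  ring

end FundamentalMatrix

theorem mainTheorem7_general (𝕜 : Type*) [Field 𝕜] [Infinite 𝕜] (n : ℕ) (hn : 8 ≤ n) :
    HoldsGenerically (fun X Y : Fin n → ProjSpace 𝕜 2 =>
      ¬ ∃ A B : FlatlandCamera 𝕜, SameImage A B X Y) := by
  obtain ⟨σ⟩ : Nonempty ({r : Fin 3 × Fin 3 // r ≠ (0, 0)} ↪ Fin n) :=
    Function.Embedding.nonempty_of_card_le (by simpa using hn)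
  have hf := isMultihomogeneous_interpolatingDetPoly (K := 𝕜) σ
  refine ⟨nonvanishingLocus (interpolatingDetPoly 𝕜 σ), hf.isOpen_nonvanishingLocus,
    hf.dense_nonvanishingLocus (interpolatingDetPoly_ne_zero 𝕜 σ.injective), ?_⟩
  rintro X Y hXY ⟨A, B, hAB⟩
  refine hXY ?_
  rw [eval_interpolatingDetPoly]
  exact det_interpolatingForm_eq_zero
    (fun r => hAB.dotProduct_fundamentalMatrix_mulVec_eq_zero (σ r))
    (fundamentalMatrix_ne_zero A.rank_eq B.rank_eq)
    (det_fundamentalMatrix_eq_zero (by simp) A.mat B.mat)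

theorem mainTheorem7 (𝕜 : Type*) [RCLike 𝕜] (n : ℕ) (hn : 8 ≤ n) :
    HoldsGenerically (fun X Y : Fin n → ProjSpace 𝕜 2 =>
      ¬ ∃ A B : FlatlandCamera 𝕜, SameImage A B X Y) :=
  mainTheorem7_general 𝕜 n hn
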